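/- An ultragraph $\mathcal G=(G^0,\mathcal G^1,r,s)$ consists of countable sets $G^0$ (vertices) and $\mathcal G^1$ (edges), a map $s:\mathcal G^1\to G^0$ and a map $r$ from $\mathcal G^1$ to the nonempty subsets of $G^0$. Let $\mathcal G^0$ be the smallest family of subsets of $G^0$ that contains all $\{v\}$ ($v\in G^0$) and all $r(e)$ ($e\in\mathcal G^1$) and is closed under finite unions (so $\emptyset\in\mathcal G^0$) and under intersections of finite nonempty subfamilies. Let $R$ be a commutative ring with $1\neq 0$. The Leavitt path algebra $L_R(\mathcal G)$ is the universal (associative, not necessarily unital) $R$-algebra with generators $\{s_e,s_e^*:e\in\mathcal G^1\}\cup\{p_A:A\in\mathcal G^0\}$ and relations 1. $p_\emptyset=0$, $p_Ap_B=p_{A\cap B}$, $p_{A\cup B}=p_A+p_B-p_{A\cap B}$ for all $A,B\in\mathcal G^0$; 2. $p_{s(e)}s_e=s_ep_{r(e)}=s_e$ and $p_{r(e)}s_e^*=s_e^*p_{s(e)}=s_e^*$ for all $e\in\mathcal G^1$, where $p_v:=p_{\{v\}}$ for $v\in G^0$; 3. $s_e^*s_f=\delta_{e,f}\,p_{r(e)}$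 for all $e,f\in\mathcal G^1$; 4. $p_v=\sum_{s(e)=v}s_es_e^*$ for every $v\in G^0$ with $0<|s^{-1}(v)|<\infty$. A finite path of length $n\ge 1$ is a sequence of edges $\alpha=\alpha_1\cdots\alpha_n$ with $s(\alpha_{i+1})\in r(\alpha_i)$ for $1\le i<n$; put $s(\alpha)=s(\alpha_1)$, $r(\alpha)=r(\alpha_n)$. An infinite path is a sequence $\alpha_1\alpha_2\cdots$ of edges with $s(\alpha_{i+1})\in r(\alpha_i)$ for all $i\geq 1$, with source $s(\alpha_1)$. A vertex $v$ is a sink if $s^{-1}(v)=\emptyset$. Let $\mathfrak p^\infty$ be the set of infinite paths and let $\mathfrak p^*$ be the set of all pairs $(\alpha,v)$ with $\alpha$ a finite path of length $\ge1$ and $v\in r(\alpha)$ a sink, together with all pairs $(v,v)$ with $v$ a sink; put $s(\alpha,v)=s(\alpha)$ and $s(v,v)=v$. Let $\mathbb P$ be the free $R$-module with basis $\{b_\alpha:\alpha\in\mathfrak p^*\cup\mathfrak p^\infty\}$. Writing $[q]=1$ if $q$ is true and $[q]=0$ otherwise, let $\pi:L_R(\mathcal G)\to \mathrm{End}_R(\mathbb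 P)$ be the homomorphism of $R$-algebras determined by $$\pi(p_A)b_\alpha=[s(\alpha)\in A]\,b_\alpha,\qquad \pi(s_e)b_\alpha=[s(\alpha)\in r(e)]\,b_{e\alpha},\qquad \pi(s_e^*)b_\alpha=[\alpha_1=e]\,b_{\alpha_2\alpha_3\cdots},$$ where $e(\alpha,v)=(e\alpha,v)$, $e(v,v)=(e,v)$, removing the first edge of $(\alpha_1\alpha_2\cdots\alpha_n,v)$ gives $(\alpha_2\cdots\alpha_n,v)$ if $n\ge2$ and $(v,v)$ if $n=1$, and $\pi(s_e^*)b_{(v,v)}=0$. A closed path is a finite path $\alpha=\alpha_1\cdots\alpha_n$ with $n\ge1$ and $s(\alpha)\in r(\alpha)$. An exit for it is either an edge $e$ such that $s(e)\in r(\alpha_i)$ and $e\ne\alpha_{i+1}$ for some $1\le i\le n$ (where $\alpha_{n+1}:=\alpha_1$), or a sink $w$ with $w\in r(\alpha_i)$ for some $1\le i\le n$. The ultragraph $\mathcal G$ satisfies Condition (L) if every closed path has an exit. **Theorem.** For every ultragraph $\mathcal G$ (no row-finiteness is assumed) and every commutative ring $R$ with $1\ne0$, the representation $\pi$ is faithful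 (that is, injective) if and only if $\mathcal G$ satisfies Condition (L). -/

import Mathlib

universe u v w

/-- An ultragraph with vertex set `V` and edge set `E`: every edge has a source vertex and a
nonempty set of range vertices. (Countability of `V` and `E` is a separate assumption.) -/
structure Ultragraph (V : Type u) (E : Type v) where
  /-- the source of an edge -/
  src : E → V
  /-- the range of an edge, a set of vertices -/
  rng : E → Set V
  /-- ranges are nonempty -/
  rng_nonempty : ∀ e, (rng e).Nonempty

namespace Ultragraph

/-! ### Generalized vertices, sinks and paths -/

section Combinatorics

variable {V : Type u} {E : Type v} (G : Ultragraph V E)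

/-- The generalized vertices: the smallest family of sets of vertices that contains the
singletons and the ranges of edges and is closed under finite unions (the empty one included)
and under intersections of finitely many, at least one, members. -/
inductive IsGenVertex : Set V → Prop
  | empty : IsGenVertex ∅
  | vertex (v : V) : IsGenVertex {v}
  | range (e : E) : IsGenVertex (G.rng e)
  | union {A B : Set V} : IsGenVertex A → IsGenVertex B → IsGenVertex (A ∪ B)
  | inter {A B : Set V} : IsGenVertex A → IsGenVertex B → IsGenVertex (A ∩ B)

/-- The type of generalized vertices. -/
abbrev GenVertex : Type u := {A : Set V // G.IsGenVertex A}

/-- A vertex is a sink if it emits no edge. -/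
def IsSink (v : V) : Prop := ∀ e, G.src e ≠ v

/-- Consecutive edges of the list are composable: `s(e_{i+1}) ∈ r(e_i)`. The nonempty such lists
are the finite paths of positive length. -/
def IsPath (α : List E) : Prop := List.IsChain (fun e f => G.src f ∈ G.rng e) α

/-- `e_1 e_2 …` is an infinite path: `s(e_{i+1}) ∈ r(e_i)` for all `i`. -/
def IsInfPath (x : ℕ → E) : Prop := ∀ i, G.src (x (i + 1)) ∈ G.rng (x i)

/-- The pair `(α, v)` lies in `𝔭*`: `α` is a finite path and `v` is a sink with `v ∈ r(α)`.
The empty list of edges stands for the pair `(v, v)`, which only requires `v` to be a sink. -/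
def IsSinkPath (α : List E) (v : V) : Prop :=
  G.IsPath α ∧ (∀ e ∈ α.getLast?, v ∈ G.rng e) ∧ G.IsSink v

/-- The disjoint union of `𝔭*` (finite paths ending in a sink) and `𝔭^∞` (infinite paths). -/
inductive BasisPath : Type (max u v)
  | fin (α : List E) (v : V) (h : G.IsSinkPath α v)
  | inf (x : ℕ → E) (h : G.IsInfPath x)

/-- A closed path: a path `α` of positive length with `s(α) ∈ r(α)`. -/
def IsClosedPath (α : List E) : Prop :=
  G.IsPath α ∧ ∃ h : α ≠ [], G.src (α.head h) ∈ G.rng (α.getLast h)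

/-- The closed path `α` has an exit: for some `i`, either an edge `e ≠ α_{i+1}` with
`s(e) ∈ r(α_i)`, or a sink in `r(α_i)`. Indices are cyclic, the first edge follows the last. -/
def HasExit (α : List E) : Prop :=
  ∃ (i : ℕ) (hi : i < α.length),
    (∃ e, G.src e ∈ G.rng α[i] ∧ e ≠ α[(i + 1) % α.length]'(Nat.mod_lt _ (by omega))) ∨
    (∃ w, G.IsSink w ∧ w ∈ G.rng α[i])

/-- Condition (L): every closed path has an exit. -/
def ConditionL : Prop := ∀ α : List E, G.IsClosedPath α → G.HasExit α

end Combinatorics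

/-! ### The Leavitt path algebra of an ultragraph

It is in general a non-unital algebra: the quotient of the free non-unital associative algebra
on the generators by the congruence generated by the defining relations. -/

section Algebra

variable {V : Type u} {E : Type v} (G : Ultragraph V E) (R : Type w) [CommRing R]

/-- The generators `p_A`, `s_e` and `s_e^*`. -/
inductive Gen : Type (max u v)
  | p (A : G.GenVertex)
  | s (e : E)
  | sStar (e : E)

/-- The free non-unital associative `R`-algebra on the generators: `R`-linear combinations of
nonempty words. -/
abbrev FreeAlg : Type (max u v w) := MonoidAlgebra R (FreeSemigroup G.Gen)

/-- A generator as an element of the free algebra. -/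
noncomputable def gen (x : G.Gen) : G.FreeAlg R := MonoidAlgebra.single (FreeSemigroup.of x) 1

/-- The defining relations of the Leavitt path algebra and their scalar multiples. -/
inductive Rel : G.FreeAlg R → G.FreeAlg R → Prop
  | p_empty : Rel (G.gen R (.p ⟨∅, .empty⟩)) 0
  | p_inter (A B : G.GenVertex) :
      Rel (G.gen R (.p A) * G.gen R (.p B)) (G.gen R (.p ⟨A.1 ∩ B.1, .inter A.2 B.2⟩))
  | p_union (A B : G.GenVertex) :
      Rel (G.gen R (.p ⟨A.1 ∪ B.1, .union A.2 B.2⟩))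
        (G.gen R (.p A) + G.gen R (.p B) - G.gen R (.p ⟨A.1 ∩ B.1, .inter A.2 B.2⟩))
  | src_s (e : E) :
      Rel (G.gen R (.p ⟨{G.src e}, .vertex _⟩) * G.gen R (.s e)) (G.gen R (.s e))
  | s_rng (e : E) :
      Rel (G.gen R (.s e) * G.gen R (.p ⟨G.rng e, .range e⟩)) (G.gen R (.s e))
  | rng_sStar (e : E) :
      Rel (G.gen R (.p ⟨G.rng e, .range e⟩) * G.gen R (.sStar e)) (G.gen R (.sStar e))
  | sStar_src (e : E) :
      Rel (G.gen R (.sStar e) * G.gen R (.p ⟨{G.src e}, .vertex _⟩)) (G.gen R (.sStar e))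
  | sStar_s_self (e : E) :
      Rel (G.gen R (.sStar e) * G.gen R (.s e)) (G.gen R (.p ⟨G.rng e, .range e⟩))
  | sStar_s_ne (e f : E) (h : e ≠ f) : Rel (G.gen R (.sStar e) * G.gen R (.s f)) 0
  | p_vertex (v : V) (hfin : {e | G.src e = v}.Finite) (hne : {e | G.src e = v}.Nonempty) :
      Rel (G.gen R (.p ⟨{v}, .vertex v⟩))
        (∑ e ∈ hfin.toFinset, G.gen R (.s e) * G.gen R (.sStar e))
  | smul (c : R) {a b : G.FreeAlg R} : Rel a b → Rel (c • a) (c • b)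

/-- The congruence generated by the defining relations. -/
noncomputable def con : RingCon (G.FreeAlg R) := ringConGen (G.Rel R)

theorem con_smul (c : R) {a b : G.FreeAlg R} (h : G.con R a b) : G.con R (c • a) (c • b) := by
  change RingConGen.Rel (G.Rel R) a b at h
  change RingConGen.Rel (G.Rel R) (c • a) (c • b)
  induction h generalizing c with
  | of x y h => exact .of _ _ (h.smul c)
  | refl x => exact .refl _
  | symm _ ih => exact (ih c).symm
  | trans _ _ ih₁ ih₂ => exact (ih₁ c).trans (ih₂ c)
  | add _ _ ih₁ ih₂ => rw [smul_add, smul_add]; exact (ih₁ c).add (ih₂ c)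
  | mul _ h₂ ih₁ _ => rw [← smul_mul_assoc, ← smul_mul_assoc]; exact (ih₁ c).mul h₂

/-- The Leavitt path algebra `L_R(G)` of the ultragraph `G`. -/
def LeavittPathAlgebra : Type (max u v w) := (G.con R).Quotient

namespace LeavittPathAlgebra

noncomputable instance : NonUnitalRing (G.LeavittPathAlgebra R) :=
  inferInstanceAs (NonUnitalRing (G.con R).Quotient)

/-- The class of an element of the free algebra. -/
noncomputable def mk (a : G.FreeAlg R) : G.LeavittPathAlgebra R := RingCon.toQuotient (c := G.con R) a

theorem mk_surjective : Function.Surjective (mk G R) := Quotient.mk_surjective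

noncomputable instance : SMul R (G.LeavittPathAlgebra R) where
  smul c := Quotient.map (c • ·) fun _ _ h => G.con_smul R c h

noncomputable instance : Module R (G.LeavittPathAlgebra R) :=
  Function.Surjective.module R
    (⟨⟨mk G R, rfl⟩, fun _ _ => rfl⟩ : G.FreeAlg R →+ G.LeavittPathAlgebra R)
    (mk_surjective G R) fun _ _ => rfl

instance : IsScalarTower R (G.LeavittPathAlgebra R) (G.LeavittPathAlgebra R) where
  smul_assoc c x y := by
    obtain ⟨a, rfl⟩ := mk_surjective G R x
    obtain ⟨b, rfl⟩ := mk_surjective G R y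
    exact congrArg (mk G R) (smul_mul_assoc c a b)

instance : SMulCommClass R (G.LeavittPathAlgebra R) (G.LeavittPathAlgebra R) where
  smul_comm c x y := by
    obtain ⟨a, rfl⟩ := mk_surjective G R x
    obtain ⟨b, rfl⟩ := mk_surjective G R y
    exact (congrArg (mk G R) (mul_smul_comm c a b)).symm

/-- A generator as an element of the Leavitt path algebra. -/
noncomputable def of (x : G.Gen) : G.LeavittPathAlgebra R := mk G R (G.gen R x)

variable {A : Type*} [NonUnitalRing A] [Module R A] [IsScalarTower R A A] [SMulCommClass R A A]

/-- The homomorphism from the free algebra with prescribed values on the generators. -/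
noncomputable def freeLift (f : G.Gen → A) : G.FreeAlg R →ₙₐ[R] A :=
  MonoidAlgebra.liftMagma R (FreeSemigroup.lift f)

theorem freeLift_gen (f : G.Gen → A) (x : G.Gen) : freeLift G R f (G.gen R x) = f x := by
  simp [freeLift, gen]

/-- The defining relations, for a family of elements of an algebra. -/
structure Satisfies (f : G.Gen → A) : Prop where
  p_empty : f (.p ⟨∅, .empty⟩) = 0
  p_inter : ∀ A B : G.GenVertex, f (.p A) * f (.p B) = f (.p ⟨A.1 ∩ B.1, .inter A.2 B.2⟩)
  p_union : ∀ A B : G.GenVertex, f (.p ⟨A.1 ∪ B.1, .union A.2 B.2⟩) =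
    f (.p A) + f (.p B) - f (.p ⟨A.1 ∩ B.1, .inter A.2 B.2⟩)
  src_s : ∀ e, f (.p ⟨{G.src e}, .vertex _⟩) * f (.s e) = f (.s e)
  s_rng : ∀ e, f (.s e) * f (.p ⟨G.rng e, .range e⟩) = f (.s e)
  rng_sStar : ∀ e, f (.p ⟨G.rng e, .range e⟩) * f (.sStar e) = f (.sStar e)
  sStar_src : ∀ e, f (.sStar e) * f (.p ⟨{G.src e}, .vertex _⟩) = f (.sStar e)
  sStar_s_self : ∀ e, f (.sStar e) * f (.s e) = f (.p ⟨G.rng e, .range e⟩)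
  sStar_s_ne : ∀ e e', e ≠ e' → f (.sStar e) * f (.s e') = 0
  p_vertex : ∀ (v : V) (hfin : {e | G.src e = v}.Finite), {e | G.src e = v}.Nonempty →
    f (.p ⟨{v}, .vertex v⟩) = ∑ e ∈ hfin.toFinset, f (.s e) * f (.sStar e)

variable {G}

theorem Satisfies.freeLift_eq {f : G.Gen → A} (hf : Satisfies G f) {a b : G.FreeAlg R}
    (h : G.con R a b) : freeLift G R f a = freeLift G R f b := by
  change RingConGen.Rel (G.Rel R) a b at h
  induction h with
  | of x y h =>
    induction h with
    | p_empty => simpa [freeLift_gen] using hf.p_empty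
    | p_inter A B => simpa [freeLift_gen] using hf.p_inter A B
    | p_union A B => simpa [freeLift_gen] using hf.p_union A B
    | src_s e => simpa [freeLift_gen] using hf.src_s e
    | s_rng e => simpa [freeLift_gen] using hf.s_rng e
    | rng_sStar e => simpa [freeLift_gen] using hf.rng_sStar e
    | sStar_src e => simpa [freeLift_gen] using hf.sStar_src e
    | sStar_s_self e => simpa [freeLift_gen] using hf.sStar_s_self e
    | sStar_s_ne e e' h => simpa [freeLift_gen] using hf.sStar_s_ne e e' h
    | p_vertex v hfin hne => simpa [freeLift_gen] using hf.p_vertex v hfin hne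
    | smul c _ ih => rw [map_smul, map_smul, ih]
  | refl x => rfl
  | symm _ ih => exact ih.symm
  | trans _ _ ih₁ ih₂ => exact ih₁.trans ih₂
  | add _ _ ih₁ ih₂ => rw [map_add, map_add, ih₁, ih₂]
  | mul _ _ ih₁ ih₂ => rw [map_mul, map_mul, ih₁, ih₂]

/-- The universal property (existence): a family that satisfies the defining relations extends
to a homomorphism of non-unital `R`-algebras. -/
noncomputable def lift (f : G.Gen → A) (hf : Satisfies G f) : G.LeavittPathAlgebra R →ₙₐ[R] A where
  toFun := Quotient.lift (freeLift G R f) fun _ _ h => hf.freeLift_eq R h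
  map_smul' c x := by
    obtain ⟨a, rfl⟩ := mk_surjective G R x
    exact map_smul (freeLift G R f) c a
  map_zero' := map_zero (freeLift G R f)
  map_add' x y := by
    obtain ⟨a, rfl⟩ := mk_surjective G R x
    obtain ⟨b, rfl⟩ := mk_surjective G R y
    exact map_add (freeLift G R f) a b
  map_mul' x y := by
    obtain ⟨a, rfl⟩ := mk_surjective G R x
    obtain ⟨b, rfl⟩ := mk_surjective G R y
    exact map_mul (freeLift G R f) a b

theorem lift_of (f : G.Gen → A) (hf : Satisfies G f) (x : G.Gen) :
    lift R f hf (of G R x) = f x := freeLift_gen G R f x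

end LeavittPathAlgebra

end Algebra

/-! ### The representation on the free module with basis `𝔭* ∪ 𝔭^∞` -/

namespace BasisPath

variable {V : Type u} {E : Type v} {G : Ultragraph V E}

/-- The source of a path; the source of `(v, v)` is `v`. -/
def source : G.BasisPath → V
  | fin [] v _ => v
  | fin (e :: _) _ _ => G.src e
  | inf x _ => G.src (x 0)

/-- The first edge of a path, if there is one (there is none for `(v, v)`). -/
def first : G.BasisPath → Option E
  | fin [] _ _ => none
  | fin (e :: _) _ _ => some e
  | inf x _ => some (x 0)

/-- The path `eα`, for `s(α) ∈ r(e)`; for `α = (v, v)` it is `(e, v)`. -/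
def cons (e : E) : (x : G.BasisPath) → source x ∈ G.rng e → G.BasisPath
  | fin [] v h, hx => fin [e] v ⟨List.isChain_singleton e, by simpa [source] using hx, h.2.2⟩
  | fin (f :: α) v h, hx =>
      fin (e :: f :: α) v ⟨List.isChain_cons_cons.2 ⟨hx, h.1⟩, by simpa using h.2.1, h.2.2⟩
  | inf x h, hx => inf (fun n => Nat.casesOn n e x) fun i => by
      cases i with
      | zero => exact hx
      | succ i => exact h i

/-- The path with its first edge removed, so that the tail of `(e, v)` is `(v, v)`.
The value at `(v, v)`, which has no first edge, is irrelevant. -/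
def tail : G.BasisPath → G.BasisPath
  | fin [] v h => fin [] v h
  | fin (_ :: []) v h => fin [] v ⟨List.isChain_nil, by simp, h.2.2⟩
  | fin (_ :: f :: α) v h =>
      fin (f :: α) v ⟨(List.isChain_cons_cons.1 h.1).2, by simpa using h.2.1, h.2.2⟩
  | inf x h => inf (fun n => x (n + 1)) fun i => h (i + 1)

theorem first_cons (e : E) (x : G.BasisPath) (h) : first (cons e x h) = some e := by
  rcases x with ⟨_ | _, _, _⟩ | _ <;> rfl

theorem source_cons (e : E) (x : G.BasisPath) (h) : source (cons e x h) = G.src e := by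
  rcases x with ⟨_ | _, _, _⟩ | _ <;> rfl

theorem tail_cons (e : E) (x : G.BasisPath) (h) : tail (cons e x h) = x := by
  rcases x with ⟨_ | _, _, _⟩ | _ <;> rfl

theorem source_of_first {e : E} {x : G.BasisPath} (h : first x = some e) :
    source x = G.src e := by
  rcases x with ⟨_ | _, _, _⟩ | _ <;> simp_all [first, source]

theorem source_tail_mem {e : E} {x : G.BasisPath} (h : first x = some e) :
    source (tail x) ∈ G.rng e := by
  rcases x with ⟨_ | ⟨f, _ | ⟨g, α⟩⟩, v, hx⟩ | ⟨x, hx⟩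
  · simp [first] at h
  · obtain rfl : f = e := by simpa [first] using h
    simpa [source, tail] using hx.2.1
  · obtain rfl : f = e := by simpa [first] using h
    exact (List.isChain_cons_cons.1 hx.1).1
  · obtain rfl : x 0 = e := by simpa [first] using h
    exact hx 0

theorem cons_tail {e : E} {x : G.BasisPath} (h : first x = some e) :
    cons e (tail x) (source_tail_mem h) = x := by
  rcases x with ⟨_ | ⟨f, _ | ⟨g, α⟩⟩, v, hx⟩ | ⟨x, hx⟩
  · simp [first] at h
  · obtain rfl : f = e := by simpa [first] using h
    rfl
  · obtain rfl : f = e := by simpa [first] using h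
    rfl
  · obtain rfl : x 0 = e := by simpa [first] using h
    simp only [tail, cons]
    congr 1
    funext n
    cases n <;> rfl

theorem exists_first {x : G.BasisPath} {e : E} (h : G.src e = source x) :
    ∃ f, first x = some f := by
  rcases x with ⟨_ | ⟨f, α⟩, v, hx⟩ | ⟨x, hx⟩
  · exact absurd h (hx.2.2 e)
  · exact ⟨f, rfl⟩
  · exact ⟨x 0, rfl⟩

end BasisPath

section Representation

open BasisPath
open scoped Classical in
/-- The values of the operators `P_A`, `S_e`, `S_e^*` on the basis:
`P_A b_α = [s(α) ∈ A] b_α`, `S_e b_α = [s(α) ∈ r(e)] b_{eα}` and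
`S_e^* b_α = [α_1 = e] b_{α_2 α_3 …}`. -/
noncomputable def actBasis {V : Type u} {E : Type v} (G : Ultragraph V E) (R : Type w) [CommRing R]
    (x : G.BasisPath) : G.Gen → (G.BasisPath →₀ R)
  | .p A => if source x ∈ A.1 then Finsupp.single x 1 else 0
  | .s e => if h : source x ∈ G.rng e then Finsupp.single (cons e x h) 1 else 0
  | .sStar e => if first x = some e then Finsupp.single (tail x) 1 else 0

variable {V : Type u} {E : Type v} (G : Ultragraph V E) (R : Type w) [CommRing R]

/-- The operators `P_A`, `S_e`, `S_e^*` on the free `R`-module with basis `𝔭* ∪ 𝔭^∞`. -/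
noncomputable def act (g : G.Gen) : Module.End R (G.BasisPath →₀ R) :=
  Finsupp.linearCombination R fun x => G.actBasis R x g

theorem act_single (g : G.Gen) (x : G.BasisPath) :
    G.act R g (Finsupp.single x 1) = G.actBasis R x g := by
  simp [act]

theorem act_satisfies : LeavittPathAlgebra.Satisfies G (G.act R) := by
  classical
  have key : ∀ S T : Module.End R (G.BasisPath →₀ R),
      (∀ x, S (Finsupp.single x 1) = T (Finsupp.single x 1)) → S = T := fun S T h => by
    ext1 x
    ext1
    exact h x
  constructor
  · refine key _ _ fun x => ?_
    simp [act_single, actBasis]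
  · intro A B
    refine key _ _ fun x => ?_
    by_cases hA : source x ∈ A.1 <;> by_cases hB : source x ∈ B.1 <;>
      simp [act_single, actBasis, hA, hB]
  · intro A B
    refine key _ _ fun x => ?_
    by_cases hA : source x ∈ A.1 <;> by_cases hB : source x ∈ B.1 <;>
      simp [act_single, actBasis, hA, hB]
  · intro e
    refine key _ _ fun x => ?_
    by_cases h : source x ∈ G.rng e <;> simp [act_single, actBasis, h, source_cons]
  · intro e
    refine key _ _ fun x => ?_
    by_cases h : source x ∈ G.rng e <;> simp [act_single, actBasis, h]
  · intro e
    refine key _ _ fun x => ?_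
    by_cases h : first x = some e
    · simp [act_single, actBasis, h, source_tail_mem h]
    · simp [act_single, actBasis, h]
  · intro e
    refine key _ _ fun x => ?_
    by_cases h : first x = some e
    · simp [act_single, actBasis, h, source_of_first h]
    · by_cases h' : source x = G.src e <;> simp [act_single, actBasis, h, h']
  · intro e
    refine key _ _ fun x => ?_
    by_cases h : source x ∈ G.rng e <;> simp [act_single, actBasis, h, first_cons, tail_cons]
  · intro e f hef
    refine key _ _ fun x => ?_
    by_cases h : source x ∈ G.rng f <;>
      simp [act_single, actBasis, h, first_cons, Ne.symm hef]
  · intro v hfin hne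
    refine key _ _ fun x => ?_
    have hterm : ∀ e, (G.act R (.s e) * G.act R (.sStar e)) (Finsupp.single x 1) =
        if first x = some e then Finsupp.single x 1 else 0 := fun e => by
      by_cases h : first x = some e
      · simp [act_single, actBasis, h, source_tail_mem h, cons_tail h]
      · simp [act_single, actBasis, h]
    rw [LinearMap.sum_apply, Finset.sum_congr rfl fun e _ => hterm e]
    by_cases hv : source x = v
    · obtain ⟨e, he⟩ := hne
      obtain ⟨f, hf⟩ := exists_first (x := x) (e := e) (he.trans hv.symm)
      have hfv : G.src f = v := (source_of_first hf).symm.trans hv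
      simp [act_single, actBasis, hv, hf, hfv]
    · rw [Finset.sum_eq_zero]
      · simp [act_single, actBasis, hv]
      · intro e he
        rw [if_neg]
        intro h
        exact hv ((source_of_first h).trans (by simpa using he))

/-- The representation `π : L_R(G) → End_R(ℙ)`, the homomorphism of (non-unital) `R`-algebras with
`π(p_A) = P_A`, `π(s_e) = S_e` and `π(s_e^*) = S_e^*`. -/
noncomputable def chenRep : G.LeavittPathAlgebra R →ₙₐ[R] Module.End R (G.BasisPath →₀ R) :=
  LeavittPathAlgebra.lift R (G.act R) (G.act_satisfies R)

theorem chenRep_of (g : G.Gen) : G.chenRep R (LeavittPathAlgebra.of G R g) = G.act R g :=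
  LeavittPathAlgebra.lift_of R _ _ g

end Representation

end Ultragraph

/-! Sufficiency of Condition (L). Every element of $L_R(\mathcal G)$ is a combination of products
$s_\alpha p_A s_\beta^*$, and induction on the maximal length of $\beta$ shows that $\pi(x)=0$
forces $x=0$. Each $xs_e$ has shorter $\beta$'s, so $xs_e=0$. Writing $x=z+\sum_{e\in F}y_es_e^*$
with $z$ a combination of elements $s_\alpha p_A$, this gives $x=z-\sum_{e\in F}zs_es_e^*$. Let $T$
be the finite set of vertices that emit at least one edge and only edges in $F$. From $v\notin T$
there is a basis path $y$ whose first edge, if any, is not in $F$, so $\pi(z)b_y=0$. Condition (L)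
lets $y$ be chosen without small periods (`exists_not_isPeriodic`); then the paths $\alpha y$ are
distinct and the coefficients of $z$ at $v$ vanish. A valuation argument (`valuation_sum_eq`) turns
this pointwise vanishing into $z=zp_T$. As $p_T=\sum_{v\in T}p_v$, relation 4 yields $x=0$; it is
used only at vertices of finite emission, so row-finiteness plays no role. Necessity. If a closed
path $\alpha$ with source $v$ has no exit, the only basis path from $v$ is $\alpha\alpha\cdots$,
hence $\pi(s_\alpha p_v)=\pi(p_v)$. But $s_\alpha p_v\ne p_v$: they have different degrees in the
$\mathbb Z$-grading, and $\pi(p_v)\ne0$. -/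

namespace Ultragraph

/-! ### Valuations on lattices of sets -/

section Valuation

variable {K V R M : Type*} [Max K] [Min K] [CommRing R] [AddCommGroup M] [Module R M]

/-- The left side is the integral of $c_0+\sum c_i1_{a_i}$ over $C\setminus D$ with respect to
$\varphi$. The lattice has no complements, so regions are carried as pairs $(C,D)$. The induction
cuts the region along $a_i$: inside $a_i$ the constant becomes $c_0+c_i$, outside it stays $c_0$. -/
theorem valuation_sum_sub_eq_zero_aux (m : K → Set V)
    (m_sup : ∀ a b, m (a ⊔ b) = m a ∪ m b) (m_inf : ∀ a b, m (a ⊓ b) = m a ∩ m b)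
    (φ : K → M) (U : Set V) (φ_congr : ∀ a b, m a ∩ U = m b ∩ U → φ a = φ b)
    (φ_sup : ∀ a b, φ (a ⊔ b) + φ (a ⊓ b) = φ a + φ b) {ι : Type*} (s : Finset ι)
    (c : ι → R) (a : ι → K) [∀ v, DecidablePred fun i => v ∈ m (a i)] (c₀ : R) (C D : K)
    (h : ∀ v ∈ m C, v ∉ m D → v ∈ U → c₀ + ∑ i ∈ s with v ∈ m (a i), c i = 0) :
    c₀ • (φ C - φ (C ⊓ D)) + ∑ i ∈ s, c i • (φ (a i ⊓ C) - φ (a i ⊓ C ⊓ D)) = 0 := by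
  classical
  induction s using Finset.induction_on generalizing c₀ C D with
  | empty =>
    simp only [Finset.sum_empty, add_zero, Finset.filter_empty] at h ⊢
    by_cases hc : c₀ = 0
    · simp [hc]
    · rw [φ_congr C (C ⊓ D), sub_self, smul_zero]
      ext v
      have := h v
      simp only [m_inf, Set.mem_inter_iff]
      tauto
  | insert i s his ih =>
    have h₁ := ih (c₀ + c i) (C ⊓ a i) D fun v hv hD hU => by
      rw [m_inf] at hv
      have := h v hv.1 hD hU
      rwa [Finset.filter_insert, if_pos hv.2, Finset.sum_insert (by simp [his]), ← add_assoc]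
        at this
    have h₂ := ih c₀ C (D ⊔ a i) fun v hv hD hU => by
      rw [m_sup] at hD
      have := h v hv (fun h => hD (.inl h)) hU
      rwa [Finset.filter_insert, if_neg fun h => hD (.inr h)] at this
    -- Additivity of the cut of $X\setminus D$ along $a_i$: modularity for $X\cap D$ and $X\cap
    -- a_i$.
    have key : ∀ X, φ (X ⊓ a i) - φ (X ⊓ a i ⊓ D) + (φ X - φ (X ⊓ (D ⊔ a i))) =
        φ X - φ (X ⊓ D) := fun X => by
      have h₃ := φ_sup (X ⊓ D) (X ⊓ a i)
      rw [φ_congr (X ⊓ D ⊔ X ⊓ a i) (X ⊓ (D ⊔ a i)) (by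
          ext; simp only [m_inf, m_sup, Set.mem_inter_iff, Set.mem_union]; tauto),
        φ_congr (X ⊓ D ⊓ (X ⊓ a i)) (X ⊓ a i ⊓ D) (by
          ext; simp only [m_inf, Set.mem_inter_iff]; tauto)] at h₃
      rw [eq_sub_of_add_eq h₃]
      abel
    rw [Finset.sum_insert his]
    have h₄ : ∀ j, φ (a j ⊓ (C ⊓ a i)) = φ (a j ⊓ C ⊓ a i) := fun j => φ_congr _ _ (by
      ext; simp only [m_inf, Set.mem_inter_iff]; tauto)
    have h₅ : ∀ j, φ (a j ⊓ (C ⊓ a i) ⊓ D) = φ (a j ⊓ C ⊓ a i ⊓ D) := fun j => φ_congr _ _ (by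
      ext; simp only [m_inf, Set.mem_inter_iff]; tauto)
    have h₆ : φ (a i ⊓ C) = φ (C ⊓ a i) := φ_congr _ _ (by
      ext; simp only [m_inf, Set.mem_inter_iff]; tauto)
    have h₇ : φ (a i ⊓ C ⊓ D) = φ (C ⊓ a i ⊓ D) := φ_congr _ _ (by
      ext; simp only [m_inf, Set.mem_inter_iff]; tauto)
    have hs : ∑ j ∈ s, c j • (φ (a j ⊓ C) - φ (a j ⊓ C ⊓ D)) =
        ∑ j ∈ s, c j • (φ (a j ⊓ (C ⊓ a i)) - φ (a j ⊓ (C ⊓ a i) ⊓ D)) +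
        ∑ j ∈ s, c j • (φ (a j ⊓ C) - φ (a j ⊓ C ⊓ (D ⊔ a i))) := by
      rw [← Finset.sum_add_distrib]
      refine Finset.sum_congr rfl fun j _ => ?_
      rw [← smul_add, h₄, h₅, key]
    rw [hs, h₆, h₇, ← key C, smul_add]
    linear_combination (norm := module) h₁ + h₂

/-- A valuation `φ` on a lattice of sets that only depends on the part of a set inside `U`
respects the linear relations between indicator functions that hold on `U` outside `T`. -/
theorem valuation_sum_eq (m : K → Set V)
    (m_sup : ∀ a b, m (a ⊔ b) = m a ∪ m b) (m_inf : ∀ a b, m (a ⊓ b) = m a ∩ m b)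
    (φ : K → M) (U : Set V) (φ_congr : ∀ a b, m a ∩ U = m b ∩ U → φ a = φ b)
    (φ_sup : ∀ a b, φ (a ⊔ b) + φ (a ⊓ b) = φ a + φ b) {ι : Type*} (s : Finset ι)
    (c : ι → R) (a : ι → K) [∀ v, DecidablePred fun i => v ∈ m (a i)] (T : K)
    (h : ∀ v ∈ U, v ∉ m T → ∑ i ∈ s with v ∈ m (a i), c i = 0) :
    ∑ i ∈ s, c i • φ (a i) = ∑ i ∈ s, c i • φ (a i ⊓ T) := by
  classical
  -- $C$ replaces the top element that the lattice may lack.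
  obtain ⟨C, hC⟩ : ∃ C, ∀ i ∈ s, m (a i) ⊆ m C := by
    clear h
    induction s using Finset.induction_on with
    | empty => exact ⟨T, by simp⟩
    | insert i s _ ih =>
      obtain ⟨C, hC⟩ := ih
      refine ⟨a i ⊔ C, fun j hj => ?_⟩
      rw [m_sup]
      rcases Finset.mem_insert.1 hj with rfl | hj
      · exact Set.subset_union_left
      · exact (hC j hj).trans Set.subset_union_right
  have := valuation_sum_sub_eq_zero_aux m m_sup m_inf φ U φ_congr φ_sup s c a 0 C T
    fun v _ hT hU => by rw [h v hU hT, zero_add]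
  rw [zero_smul, zero_add] at this
  rw [← sub_eq_zero, ← Finset.sum_sub_distrib, ← this]
  refine Finset.sum_congr rfl fun i hi => ?_
  rw [← smul_sub, φ_congr (a i) (a i ⊓ C), φ_congr (a i ⊓ T) (a i ⊓ C ⊓ T)]
  all_goals
    ext v
    have := @hC i hi v
    simp only [m_inf, Set.mem_inter_iff]
    tauto

end Valuation

/-! ### Generalized vertices and the relations in the algebra -/

namespace GenVertex

variable {V : Type u} {E : Type v} {G : Ultragraph V E}

instance : Max G.GenVertex := ⟨fun A B => ⟨A.1 ∪ B.1, .union A.2 B.2⟩⟩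

instance : Min G.GenVertex := ⟨fun A B => ⟨A.1 ∩ B.1, .inter A.2 B.2⟩⟩

/-- The generalized vertex `{v}`. -/
def single (G : Ultragraph V E) (v : V) : G.GenVertex := ⟨{v}, .vertex v⟩

/-- The range of an edge as a generalized vertex. -/
def rng (G : Ultragraph V E) (e : E) : G.GenVertex := ⟨G.rng e, .range e⟩

/-- The empty generalized vertex. -/
def empty (G : Ultragraph V E) : G.GenVertex := ⟨∅, .empty⟩

end GenVertex

theorem isGenVertex_of_finite {V : Type u} {E : Type v} (G : Ultragraph V E) {T : Set V}
    (hT : T.Finite) : G.IsGenVertex T := by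
  induction T, hT using Set.Finite.induction_on with
  | empty => exact .empty
  | insert _ _ ih => exact .union (.vertex _) ih

namespace LeavittPathAlgebra

variable {V : Type u} {E : Type v} (G : Ultragraph V E) (R : Type w) [CommRing R]

theorem mk_eq_mk {a b : G.FreeAlg R} (h : G.Rel R a b) : mk G R a = mk G R b :=
  Quotient.sound (s := (G.con R).toSetoid) (RingConGen.Rel.of _ _ h)

theorem mk_sum {ι : Type*} (s : Finset ι) (f : ι → G.FreeAlg R) :
    mk G R (∑ i ∈ s, f i) = ∑ i ∈ s, mk G R (f i) :=
  map_sum (⟨⟨mk G R, rfl⟩, fun _ _ => rfl⟩ : G.FreeAlg R →+ G.LeavittPathAlgebra R) f s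

theorem of_satisfies : Satisfies G (of G R) where
  p_empty := mk_eq_mk G R .p_empty
  p_inter A B := mk_eq_mk G R (.p_inter A B)
  p_union A B := mk_eq_mk G R (.p_union A B)
  src_s e := mk_eq_mk G R (.src_s e)
  s_rng e := mk_eq_mk G R (.s_rng e)
  rng_sStar e := mk_eq_mk G R (.rng_sStar e)
  sStar_src e := mk_eq_mk G R (.sStar_src e)
  sStar_s_self e := mk_eq_mk G R (.sStar_s_self e)
  sStar_s_ne e f h := mk_eq_mk G R (.sStar_s_ne e f h)
  p_vertex v hfin hne := (mk_eq_mk G R (.p_vertex v hfin hne)).trans (mk_sum G R _ _)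

variable {G R}

/-- A submodule that contains the generators and is stable under right multiplication by
generators is everything. -/
theorem mem_of_mul_mem (W : Submodule R (G.LeavittPathAlgebra R)) (h : ∀ g, of G R g ∈ W)
    (hmul : ∀ x ∈ W, ∀ g, x * of G R g ∈ W) (x : G.LeavittPathAlgebra R) : x ∈ W := by
  obtain ⟨a, rfl⟩ := mk_surjective G R x
  induction a using MonoidAlgebra.induction_linear with
  | zero => exact W.zero_mem
  | add a b ha hb => exact W.add_mem ha hb
  | single m r =>
    -- The second conjunct makes the induction on words work: a word is peeled from the left, while
    -- $W$ is stable only on the right.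
    have hm : mk G R (MonoidAlgebra.single m 1) ∈ W ∧
        ∀ y ∈ W, y * mk G R (MonoidAlgebra.single m 1) ∈ W := by
      induction m using FreeSemigroup.recOnMul with
      | ih1 g => exact ⟨h g, fun y hy => hmul y hy g⟩
      | ih2 g m _ ih =>
        have : mk G R (MonoidAlgebra.single (FreeSemigroup.of g * m) 1) =
            of G R g * mk G R (MonoidAlgebra.single m 1) := by
          rw [← mul_one (1 : R), ← MonoidAlgebra.single_mul_single, mul_one]
          rfl
        rw [this]
        refine ⟨ih.2 _ (h g), fun y hy => ?_⟩
        rw [← mul_assoc]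
        exact ih.2 _ (hmul y hy g)
    have : mk G R (MonoidAlgebra.single m r) = r • mk G R (MonoidAlgebra.single m 1) := by
      rw [← mul_one r, ← smul_eq_mul, ← MonoidAlgebra.smul_single]
      simp only [smul_eq_mul, mul_one]
      rfl
    rw [this]
    exact W.smul_mem r hm.1

variable (G R)

/-- The idempotent `p_A`. -/
noncomputable def p (A : G.GenVertex) : G.LeavittPathAlgebra R := of G R (.p A)

/-- The generator `s_e`. -/
noncomputable def s (e : E) : G.LeavittPathAlgebra R := of G R (.s e)

/-- The generator `s_e^*`. -/
noncomputable def sStar (e : E) : G.LeavittPathAlgebra R := of G R (.sStar e)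

theorem p_empty : p G R (.empty G) = 0 := (of_satisfies G R).p_empty

theorem p_mul_p (A B : G.GenVertex) : p G R A * p G R B = p G R (A ⊓ B) :=
  (of_satisfies G R).p_inter A B

theorem p_sup_add_p_inf (A B : G.GenVertex) :
    p G R (A ⊔ B) + p G R (A ⊓ B) = p G R A + p G R B :=
  eq_sub_iff_add_eq.1 ((of_satisfies G R).p_union A B)

theorem p_src_mul_s (e : E) : p G R (.single G (G.src e)) * s G R e = s G R e :=
  (of_satisfies G R).src_s e

theorem s_mul_p_rng (e : E) : s G R e * p G R (.rng G e) = s G R e := (of_satisfies G R).s_rng e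

theorem p_rng_mul_sStar (e : E) : p G R (.rng G e) * sStar G R e = sStar G R e :=
  (of_satisfies G R).rng_sStar e

theorem sStar_mul_p_src (e : E) : sStar G R e * p G R (.single G (G.src e)) = sStar G R e :=
  (of_satisfies G R).sStar_src e

theorem sStar_mul_s_self (e : E) : sStar G R e * s G R e = p G R (.rng G e) :=
  (of_satisfies G R).sStar_s_self e

theorem sStar_mul_s_ne {e f : E} (h : e ≠ f) : sStar G R e * s G R f = 0 :=
  (of_satisfies G R).sStar_s_ne e f h

theorem p_single (v : V) (hfin : {e | G.src e = v}.Finite) (hne : {e | G.src e = v}.Nonempty) :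
    p G R (.single G v) = ∑ e ∈ hfin.toFinset, s G R e * sStar G R e :=
  (of_satisfies G R).p_vertex v hfin hne

theorem p_eq_zero {A : G.GenVertex} (h : A.1 = ∅) : p G R A = 0 := by
  rw [← p_empty, show A = .empty G from Subtype.ext h]

theorem p_mul_s_of_notMem {A : G.GenVertex} {e : E} (h : G.src e ∉ A.1) :
    p G R A * s G R e = 0 := by
  rw [← p_src_mul_s, ← mul_assoc, p_mul_p, p_eq_zero, zero_mul]
  exact Set.inter_singleton_eq_empty.2 h

theorem sStar_mul_p_of_mem {A : G.GenVertex} {e : E} (h : G.src e ∈ A.1) :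
    sStar G R e * p G R A = sStar G R e := by
  rw [← sStar_mul_p_src, mul_assoc, p_mul_p, show .single G (G.src e) ⊓ A = .single G (G.src e) from
    Subtype.ext (Set.inter_eq_left.2 (Set.singleton_subset_iff.2 h))]

theorem sStar_mul_p_of_notMem {A : G.GenVertex} {e : E} (h : G.src e ∉ A.1) :
    sStar G R e * p G R A = 0 := by
  rw [← sStar_mul_p_src, mul_assoc, p_mul_p, p_eq_zero, mul_zero]
  exact Set.singleton_inter_eq_empty.2 h

/-- The element `s_α p_A`, for a list `α` of edges. -/
noncomputable def sp : List E → G.GenVertex → G.LeavittPathAlgebra R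
  | [], A => p G R A
  | e :: α, A => s G R e * sp α A

theorem sp_mul_p (α : List E) (A B : G.GenVertex) : sp G R α A * p G R B = sp G R α (A ⊓ B) := by
  induction α with
  | nil => exact p_mul_p G R A B
  | cons e α ih => simp only [sp, mul_assoc, ih]

theorem sp_empty (α : List E) : sp G R α (.empty G) = 0 := by
  induction α with
  | nil => exact p_empty G R
  | cons e α ih => simp only [sp, ih, mul_zero]

theorem sp_sup_add_sp_inf (α : List E) (A B : G.GenVertex) :
    sp G R α (A ⊔ B) + sp G R α (A ⊓ B) = sp G R α A + sp G R α B := by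
  induction α with
  | nil => exact p_sup_add_p_inf G R A B
  | cons e α ih => simp only [sp, ← mul_add, ih]

theorem sp_single_mul_s (α : List E) (e : E) :
    sp G R α (.single G (G.src e)) * s G R e = sp G R (α ++ [e]) (.rng G e) := by
  induction α with
  | nil => simp only [sp, List.nil_append, p_src_mul_s, s_mul_p_rng]
  | cons f α ih => simp only [sp, List.cons_append, mul_assoc, ih]

end LeavittPathAlgebra

/-! ### Composability and the filtration by the length of $\beta$ -/

variable {V : Type u} {E : Type v} (G : Ultragraph V E)

/-- The source of the path `αx`, where `x` has source `v`. -/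
def listSource : List E → V → V
  | [], v => v
  | e :: _, _ => G.src e

/-- The path `α` can be continued by a path with source `v`. -/
def Composable : List E → V → Prop
  | [], _ => True
  | e :: α, v => G.listSource α v ∈ G.rng e ∧ Composable α v

namespace LeavittPathAlgebra

variable (R : Type w) [CommRing R]

/-- $s_\alpha$ absorbs $p_{r(\alpha)}$ on the right, and $s_\alpha p_A=0$ when $\alpha$ is not a
path. This is the locality that `valuation_sum_eq` asks of the valuation $A\mapsto s_\alpha p_A$. -/
theorem sp_congr (α : List E) (A B : G.GenVertex)
    (h : A.1 ∩ {v | G.Composable α v} = B.1 ∩ {v | G.Composable α v}) :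
    sp G R α A = sp G R α B := by
  induction α with
  | nil =>
    have : A = B := Subtype.ext (by simpa [Composable] using h)
    rw [this]
  | cons e α ih =>
    simp only [sp]
    rcases α with _ | ⟨f, α⟩
    · simp only [sp]
      rw [← s_mul_p_rng, mul_assoc, mul_assoc, p_mul_p, p_mul_p]
      have : GenVertex.rng G e ⊓ A = GenVertex.rng G e ⊓ B := by
        refine Subtype.ext ?_
        simp only [Composable, listSource, and_true, Set.ofPred_mem_eq] at h
        change G.rng e ∩ A.1 = G.rng e ∩ B.1
        rw [Set.inter_comm, h, Set.inter_comm]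
      rw [this]
    · by_cases hf : G.src f ∈ G.rng e
      · rw [ih]
        simpa only [Composable, listSource, hf, true_and] using h
      · simp only [sp]
        have : s G R e * s G R f = 0 := by
          rw [← s_mul_p_rng, mul_assoc, p_mul_s_of_notMem G R (A := .rng G e) hf, mul_zero]
        rw [← mul_assoc, ← mul_assoc, this, zero_mul, zero_mul]

/-- The span of the elements `s_α p_A`. -/
noncomputable def real : Submodule R (G.LeavittPathAlgebra R) :=
  Submodule.span R (Set.range fun q : List E × G.GenVertex => sp G R q.1 q.2)

/-- The span of the elements `s_α p_A s_β^*` with `β` of length at most `n`. -/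
noncomputable def filtration : ℕ → Submodule R (G.LeavittPathAlgebra R)
  | 0 => real G R
  | n + 1 => real G R ⊔ ⨆ e, (filtration n).map (LinearMap.mulRight R (sStar G R e))

variable {G R}

theorem sp_mem_real (α : List E) (A : G.GenVertex) : sp G R α A ∈ real G R :=
  Submodule.subset_span ⟨(α, A), rfl⟩

theorem real_mul_mem {W : Submodule R (G.LeavittPathAlgebra R)} {y : G.LeavittPathAlgebra R}
    (h : ∀ α A, sp G R α A * y ∈ W) {x} (hx : x ∈ real G R) : x * y ∈ W := by
  induction hx using Submodule.span_induction with
  | mem x hx => obtain ⟨q, rfl⟩ := hx; exact h _ _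
  | zero => rw [zero_mul]; exact W.zero_mem
  | add _ _ _ _ h₁ h₂ => rw [add_mul]; exact W.add_mem h₁ h₂
  | smul c _ _ h => rw [smul_mul_assoc]; exact W.smul_mem c h

theorem real_mul_p {x : G.LeavittPathAlgebra R} (hx : x ∈ real G R) (A : G.GenVertex) :
    x * p G R A ∈ real G R :=
  real_mul_mem (fun α B => by rw [sp_mul_p]; exact sp_mem_real _ _) hx

theorem real_mul_s {x : G.LeavittPathAlgebra R} (hx : x ∈ real G R) (e : E) :
    x * s G R e ∈ real G R := by
  refine real_mul_mem (fun α B => ?_) hx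
  rw [← p_src_mul_s, ← mul_assoc, sp_mul_p]
  by_cases h : G.src e ∈ B.1
  · rw [show B ⊓ .single G (G.src e) = .single G (G.src e) from
      Subtype.ext (Set.inter_eq_right.2 (Set.singleton_subset_iff.2 h)), sp_single_mul_s]
    exact sp_mem_real _ _
  · rw [show B ⊓ .single G (G.src e) = .empty G from
      Subtype.ext (Set.inter_singleton_eq_empty.2 h), sp_empty, zero_mul]
    exact Submodule.zero_mem _

theorem mem_filtration_succ {n : ℕ} {x : G.LeavittPathAlgebra R} :
    x ∈ filtration G R (n + 1) ↔ ∃ z ∈ real G R, ∃ (F : Finset E) (y : E → G.LeavittPathAlgebra R),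
      (∀ e, y e ∈ filtration G R n) ∧ x = z + ∑ e ∈ F, y e * sStar G R e := by
  classical
  constructor
  · intro hx
    obtain ⟨z, hz, t, ht, rfl⟩ := Submodule.mem_sup.1 hx
    obtain ⟨f, hf, rfl⟩ := (Submodule.mem_iSup_iff_exists_finsupp _ _).1 ht
    choose y hy hyf using hf
    exact ⟨z, hz, f.support, y, hy, congrArg (z + ·) (Finset.sum_congr rfl fun e _ => (hyf e).symm)⟩
  · rintro ⟨z, hz, F, y, hy, rfl⟩
    exact Submodule.add_mem_sup hz (Submodule.sum_mem _ fun e _ =>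
      Submodule.mem_iSup_of_mem e ⟨y e, hy e, rfl⟩)

theorem real_le_filtration (n : ℕ) : real G R ≤ filtration G R n := by
  cases n
  · exact le_rfl
  · exact le_sup_left

theorem filtration_le_succ (n : ℕ) : filtration G R n ≤ filtration G R (n + 1) := by
  induction n with
  | zero => exact le_sup_left
  | succ n ih =>
    intro x hx
    obtain ⟨z, hz, F, y, hy, rfl⟩ := mem_filtration_succ.1 hx
    exact mem_filtration_succ.2 ⟨z, hz, F, y, fun e => ih (hy e), rfl⟩

theorem filtration_mul_p {n : ℕ} {x : G.LeavittPathAlgebra R} (hx : x ∈ filtration G R n)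
    (A : G.GenVertex) : x * p G R A ∈ filtration G R n := by
  classical
  cases n with
  | zero => exact real_mul_p hx A
  | succ n =>
    obtain ⟨z, hz, F, y, hy, rfl⟩ := mem_filtration_succ.1 hx
    refine mem_filtration_succ.2 ⟨_, real_mul_p hz A, F, fun e => if G.src e ∈ A.1 then y e else 0,
      fun e => ?_, ?_⟩
    · by_cases h : G.src e ∈ A.1 <;> simp [h, hy]
    · rw [add_mul, Finset.sum_mul]
      congr 1
      refine Finset.sum_congr rfl fun e _ => ?_
      by_cases h : G.src e ∈ A.1
      · simp [h, mul_assoc, sStar_mul_p_of_mem]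
      · simp [h, mul_assoc, sStar_mul_p_of_notMem]

/-- Since $s_f^*s_e=\delta_{f,e}p_{r(e)}$, multiplying by $s_e$ removes a starred edge; this drives
the induction for faithfulness. -/
theorem filtration_succ_mul_s {n : ℕ} {x : G.LeavittPathAlgebra R}
    (hx : x ∈ filtration G R (n + 1)) (e : E) : x * s G R e ∈ filtration G R n := by
  obtain ⟨z, hz, F, y, hy, rfl⟩ := mem_filtration_succ.1 hx
  rw [add_mul, Finset.sum_mul]
  refine Submodule.add_mem _ (real_le_filtration n (real_mul_s hz e))
    (Submodule.sum_mem _ fun f _ => ?_)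
  rw [mul_assoc]
  rcases eq_or_ne f e with rfl | h
  · rw [sStar_mul_s_self]
    exact filtration_mul_p (hy f) _
  · rw [sStar_mul_s_ne G R h, mul_zero]
    exact Submodule.zero_mem _

theorem filtration_mul_sStar {n : ℕ} {x : G.LeavittPathAlgebra R}
    (hx : x ∈ filtration G R n) (e : E) : x * sStar G R e ∈ filtration G R (n + 1) :=
  mem_filtration_succ.2 ⟨0, Submodule.zero_mem _, {e}, fun _ => x, fun _ => hx, by simp⟩

theorem exists_mem_filtration (x : G.LeavittPathAlgebra R) : ∃ n, x ∈ filtration G R n := by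
  have hdir : Directed (· ≤ ·) (filtration G R) :=
    (monotone_nat_of_le_succ filtration_le_succ).directed_le
  rw [← Submodule.mem_iSup_of_directed _ hdir]
  refine mem_of_mul_mem _ (fun g => ?_) (fun x hx g => ?_) x
  · rw [Submodule.mem_iSup_of_directed _ hdir]
    rcases g with A | e | e
    · exact ⟨0, sp_mem_real [] A⟩
    · refine ⟨0, ?_⟩
      rw [show of G R (.s e) = sp G R [e] (.rng G e) from (s_mul_p_rng G R e).symm]
      exact sp_mem_real _ _
    · refine ⟨1, ?_⟩
      rw [show of G R (.sStar e) = p G R (.rng G e) * sStar G R e from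
        (p_rng_mul_sStar G R e).symm]
      exact filtration_mul_sStar (n := 0) (sp_mem_real [] _) e
  · rw [Submodule.mem_iSup_of_directed _ hdir] at hx ⊢
    obtain ⟨n, hn⟩ := hx
    rcases g with A | e | e
    · exact ⟨n, filtration_mul_p hn A⟩
    · exact ⟨n, filtration_succ_mul_s (filtration_le_succ n hn) e⟩
    · exact ⟨n + 1, filtration_mul_sStar hn e⟩

open scoped Classical in
/-- If the coefficients of `z = ∑ c_q s_α p_A` at all vertices outside `T` vanish, then
`z = z p_T`. -/
theorem real_eq_mul_p (c : List E × G.GenVertex →₀ R) (T : G.GenVertex)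
    (h : ∀ α, ∀ v ∉ T.1, G.Composable α v →
      ∑ q ∈ c.support with q.1 = α ∧ v ∈ q.2.1, c q = 0) :
    (c.sum fun q r => r • sp G R q.1 q.2) = (c.sum fun q r => r • sp G R q.1 q.2) * p G R T := by
  simp only [Finsupp.sum, Finset.sum_mul, smul_mul_assoc, sp_mul_p]
  have hm : ∀ q ∈ c.support, q.1 ∈ c.support.image Prod.fst := fun q hq =>
    Finset.mem_image_of_mem _ hq
  -- The identity holds for each $\alpha$ separately, as $A\mapsto s_\alpha p_A$ is a valuation for
  -- fixed $\alpha$.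
  rw [← Finset.sum_fiberwise_of_maps_to hm, ← Finset.sum_fiberwise_of_maps_to hm]
  refine Finset.sum_congr rfl fun α _ => ?_
  have key := valuation_sum_eq (R := R) (fun A : G.GenVertex => A.1) (fun _ _ => rfl)
    (fun _ _ => rfl) (sp G R α) {v | G.Composable α v} (sp_congr G R α) (sp_sup_add_sp_inf G R α)
    (c.support.filter fun q => q.1 = α) c Prod.snd T fun v hv hT => by
      rw [Finset.filter_filter]
      exact h α v hT hv
  have hl : ∀ φ : G.GenVertex → G.GenVertex,
      ∑ q ∈ c.support with q.1 = α, c q • sp G R q.1 (φ q.2) =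
        ∑ q ∈ c.support with q.1 = α, c q • sp G R α (φ q.2) := fun φ =>
    Finset.sum_congr rfl fun q hq => by rw [(Finset.mem_filter.1 hq).2]
  exact (hl id).trans (key.trans (hl (· ⊓ T)).symm)

end LeavittPathAlgebra

end Ultragraph

/-! ### Concatenation and periodicity of basis paths -/

namespace Ultragraph

namespace BasisPath

variable {V : Type u} {E : Type v} {G : Ultragraph V E}

/-- The edge of a path at a given position, if there is one. -/
def edge : G.BasisPath → ℕ → Option E
  | fin α _ _, n => α[n]?
  | inf x _, n => some (x n)

theorem edge_zero (y : G.BasisPath) : edge y 0 = first y := by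
  rcases y with ⟨_ | _, _, _⟩ | _ <;> rfl

theorem edge_cons_zero (e : E) (y : G.BasisPath) (h) : edge (cons e y h) 0 = some e := by
  rw [edge_zero, first_cons]

theorem edge_cons_succ (e : E) (y : G.BasisPath) (h) (n : ℕ) :
    edge (cons e y h) (n + 1) = edge y n := by
  rcases y with ⟨_ | _, _, _⟩ | _ <;> rfl

theorem edge_tail {y : G.BasisPath} {e : E} (h : first y = some e) (n : ℕ) :
    edge (tail y) n = edge y (n + 1) := by
  rw [← edge_cons_succ e (tail y) (source_tail_mem h), cons_tail h]

theorem exists_eq_inf {y : G.BasisPath} {n : ℕ → ℕ} (hn : ∀ k, k ≤ n k)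
    (h : ∀ k, edge y (n k) ≠ none) : ∃ x hx, y = inf x hx := by
  rcases y with ⟨α, v, hα⟩ | ⟨x, hx⟩
  · exact absurd (List.getElem?_eq_none (hn α.length)) (h _)
  · exact ⟨x, hx, rfl⟩

theorem ext_of_edge {y y' : G.BasisPath} (h : ∀ n, edge y n = edge y' n)
    (hy : ∀ n, edge y n ≠ none) : y = y' := by
  obtain ⟨x, hx, rfl⟩ := exists_eq_inf (fun _ => le_rfl) hy
  obtain ⟨x', hx', rfl⟩ := exists_eq_inf (y := y') (fun _ => le_rfl) fun n => h n ▸ hy n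
  obtain rfl : x = x' := funext fun n => Option.some_injective _ (h n)
  rfl

open scoped Classical in
/-- The path `αy`, provided that it is composable. -/
noncomputable def append : List E → G.BasisPath → G.BasisPath
  | [], y => y
  | e :: α, y => if h : source (append α y) ∈ G.rng e then cons e (append α y) h else append α y

theorem source_append {α : List E} {y : G.BasisPath} (h : G.Composable α (source y)) :
    source (append α y) = G.listSource α (source y) := by
  cases α with
  | nil => rfl
  | cons e α =>
    have h' : source (append α y) ∈ G.rng e := source_append h.2 ▸ h.1
    simp only [append, dif_pos h', source_cons, listSource]

theorem append_cons {e : E} {α : List E} {y : G.BasisPath}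
    (h : G.Composable (e :: α) (source y)) :
    append (e :: α) y = cons e (append α y) (source_append h.2 ▸ h.1) :=
  dif_pos _

theorem edge_append_of_lt {α : List E} {y : G.BasisPath} (h : G.Composable α (source y)) {n : ℕ}
    (hn : n < α.length) : edge (append α y) n = α[n]? := by
  induction α generalizing n with
  | nil => simp at hn
  | cons e α ih =>
    rw [append_cons h]
    cases n with
    | zero => rw [edge_cons_zero]; rfl
    | succ n =>
      rw [edge_cons_succ, ih h.2 (by simpa using hn)]
      simp

theorem edge_append_add {α : List E} {y : G.BasisPath} (h : G.Composable α (source y)) (n : ℕ) :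
    edge (append α y) (α.length + n) = edge y n := by
  induction α with
  | nil => simp [append]
  | cons e α ih =>
    rw [append_cons h, List.length_cons, Nat.add_right_comm, edge_cons_succ, ih h.2]

/-- A path `y` is periodic of period `d` if it is infinite and invariant under removing its first
`d` edges. -/
def IsPeriodic (y : G.BasisPath) (d : ℕ) : Prop :=
  first y ≠ none ∧ ∀ n, edge y (n + d) = edge y n

/-- If $\alpha y=\beta y$ with $|\alpha|<|\beta|$, comparing the edges from position $|\beta|$ on
shows that $y$ has period $|\beta|-|\alpha|$. -/
theorem append_injective {N : ℕ} {y : G.BasisPath} (hy : ∀ d, 0 < d → d ≤ N → ¬ IsPeriodic y d)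
    {α β : List E} (hα : G.Composable α (source y)) (hβ : G.Composable β (source y))
    (hαN : α.length ≤ N) (hβN : β.length ≤ N) (h : append α y = append β y) : α = β := by
  wlog hle : α.length ≤ β.length generalizing α β
  · exact (this hβ hα hβN hαN h.symm (le_of_not_ge hle)).symm
  rcases hle.eq_or_lt with heq | hlt
  · refine List.ext_getElem? fun n => ?_
    rcases lt_or_ge n α.length with hn | hn
    · rw [← edge_append_of_lt hα hn, h, edge_append_of_lt hβ (heq ▸ hn)]
    · rw [List.getElem?_eq_none hn, List.getElem?_eq_none (heq ▸ hn)]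
  · refine absurd ⟨?_, fun n => ?_⟩ (hy (β.length - α.length) (by omega) (by omega))
    · rw [← edge_zero, ← edge_append_add hα 0, h, add_zero, edge_append_of_lt hβ hlt]
      simpa using hlt
    · rw [← edge_append_add hα, h, ← edge_append_add hβ n]
      congr 1
      omega

-- A vertex without a basis path is not a sink, and it emits an edge whose range consists of such
-- vertices again. Following these edges produces an infinite path, a contradiction.
variable (G) in
theorem exists_source_eq (v : V) : ∃ y : G.BasisPath, source y = v := by
  by_contra hv
  have step : ∀ v : {v // ¬ ∃ y : G.BasisPath, source y = v}, ∃ e, G.src e = v.1 ∧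
      ∀ w ∈ G.rng e, ¬ ∃ y : G.BasisPath, source y = w := by
    rintro ⟨v, hv⟩
    have : ∃ e, G.src e = v := by
      by_contra hs
      exact hv ⟨fin [] v ⟨List.isChain_nil, by simp, fun e he => hs ⟨e, he⟩⟩, rfl⟩
    obtain ⟨e, rfl⟩ := this
    refine ⟨e, rfl, ?_⟩
    rintro w hw ⟨y, rfl⟩
    exact hv ⟨cons e y hw, source_cons _ _ _⟩
  choose e he hr using step
  let next : {v // ¬ ∃ y : G.BasisPath, source y = v} → {v // ¬ ∃ y : G.BasisPath, source y = v} :=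
    fun v => ⟨(G.rng_nonempty (e v)).some, hr v _ (G.rng_nonempty (e v)).some_mem⟩
  refine hv ⟨inf (fun n => e (next^[n] ⟨v, hv⟩)) fun i => ?_, he ⟨v, hv⟩⟩
  simp only [Function.iterate_succ_apply', he]
  exact (G.rng_nonempty _).some_mem

theorem exists_edge_eq_of_le (K : ℕ) {x : ℕ → E} (hx : G.IsInfPath x) {z : G.BasisPath}
    (hz : source z ∈ G.rng (x K)) : ∃ y : G.BasisPath, source y = G.src (x 0) ∧
      (∀ n ≤ K, edge y n = some (x n)) ∧ edge y (K + 1) = first z := by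
  induction K generalizing x with
  | zero =>
    refine ⟨cons (x 0) z hz, source_cons _ _ _, fun n hn => ?_, ?_⟩
    · rw [Nat.le_zero.1 hn, edge_cons_zero]
    · rw [edge_cons_succ, edge_zero]
  | succ K ih =>
    obtain ⟨y, hy, hy', hy''⟩ := ih (x := fun n => x (n + 1)) (fun i => hx (i + 1)) hz
    refine ⟨cons (x 0) y (hy ▸ hx 0), source_cons _ _ _, fun n hn => ?_, ?_⟩
    · cases n with
      | zero => rw [edge_cons_zero]
      | succ n => rw [edge_cons_succ, hy' n (by omega)]
    · rw [edge_cons_succ, hy'']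

/-- A periodic path runs around a closed path, which has an exit. Going around often enough and then
leaving through the exit destroys all periods up to $N$ and keeps the first edge. -/
theorem exists_not_isPeriodic (hL : G.ConditionL) (N : ℕ) (y : G.BasisPath) :
    ∃ y' : G.BasisPath, source y' = source y ∧ first y' = first y ∧
      ∀ d, 0 < d → d ≤ N → ¬ IsPeriodic y' d := by
  by_cases hy : ∀ d, 0 < d → d ≤ N → ¬ IsPeriodic y d
  · exact ⟨y, rfl, rfl, hy⟩
  push Not at hy
  obtain ⟨d, hd, -, hfirst, hper⟩ := hy
  have hmul : ∀ k n, edge y (n + d * k) = edge y n := fun k => by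
    induction k with
    | zero => simp
    | succ k ih => intro n; rw [Nat.mul_succ, ← add_assoc, hper, ih]
  obtain ⟨x, hx, rfl⟩ := exists_eq_inf (n := fun k => 0 + d * k)
    (fun k => by simpa using Nat.le_mul_of_pos_left k hd)
    (fun k => by rwa [hmul, edge_zero])
  have hmulx : ∀ k n, x (n + d * k) = x n := fun k n => Option.some_injective _ (hmul k n)
  obtain ⟨i, hi, hexit⟩ := hL (List.ofFn fun i : Fin d => x i) (by
    have hne : List.ofFn (fun i : Fin d => x i) ≠ [] := by simpa using hd.ne'
    refine ⟨List.isChain_iff_getElem.2 fun i hi => ?_, hne, ?_⟩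
    · simpa using hx i
    · have h1 := hx (d - 1)
      rw [Nat.sub_add_cancel hd] at h1
      rw [List.head_eq_getElem, List.getLast_eq_getElem]
      have h2 := hmulx 1 0
      simp only [mul_one, zero_add] at h2
      simpa [h2] using h1)
  simp only [List.length_ofFn, List.getElem_ofFn] at hi hexit
  have hnext : x ((i + 1) % d) = x (i + 1) := by
    conv_rhs => rw [← Nat.mod_add_div (i + 1) d, hmulx]
  obtain ⟨z, hz, hz'⟩ : ∃ z : G.BasisPath, source z ∈ G.rng (x i) ∧
      first z ≠ some (x (i + 1)) := by
    rcases hexit with ⟨e, he, hne⟩ | ⟨w, hw, hw'⟩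
    · obtain ⟨v, hv⟩ := G.rng_nonempty e
      obtain ⟨z, rfl⟩ := exists_source_eq G v
      refine ⟨cons e z hv, (source_cons e z hv).symm ▸ he, ?_⟩
      rw [first_cons, ← hnext]
      exact fun h => hne (Option.some_injective _ h)
    · exact ⟨fin [] w ⟨List.isChain_nil, by simp, hw⟩, hw', by simp [first]⟩
  -- With $N+1$ extra turns, the part shared with $x$ is long enough to step back by both $m\le N$
  -- and $d$ from the exit.
  obtain ⟨y, hy, hyx, hyz⟩ := exists_edge_eq_of_le (i + d * (N + 1)) hx (z := z)
    (by rwa [hmulx])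
  refine ⟨y, hy, ?_, fun m hm hmN hp => hz' ?_⟩
  · rw [← edge_zero, hyx 0 (Nat.zero_le _), first]
  have hdN : N + d ≤ d * (N + 1) := by nlinarith
  generalize hK : i + d * (N + 1) = K at *
  -- Periods $m$ of $y$ and $d$ of $x$ combine:
  -- $y_{K+1}=y_{K+1-m}=x_{K+1-m-d}=y_{K+1-d}=x_{K+1}=x_{i+1}$, so $y$ would not leave the cycle.
  have h1 : edge y (K + 1) = edge y (K + 1 - m) := by
    rw [← hp.2 (K + 1 - m)]; congr 1; omega
  have h2 : edge y (K + 1 - d) = edge y (K + 1 - m - d) := by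
    rw [← hp.2 (K + 1 - m - d)]; congr 1; omega
  have h3 : x (K + 1 - m) = x (K + 1 - m - d) := by
    rw [← hmulx 1 (K + 1 - m - d)]; congr 1; omega
  have h4 : x (K + 1) = x (K + 1 - d) := by
    rw [← hmulx 1 (K + 1 - d)]; congr 1; omega
  have h5 : x (K + 1) = x (i + 1) := by
    rw [← hK, Nat.add_right_comm, hmulx]
  rw [← hyz, h1, hyx _ (by omega), h3, ← hyx _ (by omega), ← h2, hyx _ (by omega), ← h4, h5]

end BasisPath

/-! ### Condition (L) implies faithfulness -/

section Representation

open BasisPath LeavittPathAlgebra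

variable {V : Type u} {E : Type v} (G : Ultragraph V E) (R : Type w) [CommRing R]

open scoped Classical in
theorem chenRep_p_single (A : G.GenVertex) (y : G.BasisPath) :
    G.chenRep R (p G R A) (Finsupp.single y 1) =
      if source y ∈ A.1 then Finsupp.single y 1 else 0 := by
  rw [p, chenRep_of, act_single]
  rfl

open scoped Classical in
theorem chenRep_sp_single (α : List E) (A : G.GenVertex) (y : G.BasisPath) :
    G.chenRep R (sp G R α A) (Finsupp.single y 1) =
      if source y ∈ A.1 ∧ G.Composable α (source y) then Finsupp.single (append α y) 1 else 0 := by
  induction α with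
  | nil => simp [sp, Composable, append, chenRep_p_single]
  | cons e α ih =>
    rw [sp, map_mul, Module.End.mul_apply, ih]
    by_cases h : source y ∈ A.1 ∧ G.Composable α (source y)
    · rw [if_pos h, LeavittPathAlgebra.s, chenRep_of, act_single]
      by_cases h' : source (append α y) ∈ G.rng e
      · have h'' : G.Composable (e :: α) (source y) := ⟨source_append h.2 ▸ h', h.2⟩
        rw [if_pos ⟨h.1, h''⟩, append_cons h'']
        exact dif_pos h'
      · rw [if_neg]
        · exact dif_neg h'
        · exact fun h'' => h' (source_append h.2 ▸ h''.2.1)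
    · rw [if_neg h, map_zero, if_neg fun h' => h ⟨h'.1, h'.2.2⟩]

open scoped Classical in
theorem chenRep_sStar_single {e : E} {y : G.BasisPath} (h : first y ≠ some e) :
    G.chenRep R (sStar G R e) (Finsupp.single y 1) = 0 := by
  rw [sStar, chenRep_of, act_single]
  exact if_neg h

variable {G R}

-- The sum is the coordinate of $\pi(z)b_y$ at $b_{\alpha y}$: without small periods, no other
-- $\beta$ occurring in $z$ has $\beta y=\alpha y$. The period bound depends on $c$ and $\alpha$,
-- whence the quantifier over $N$.
open scoped Classical in
theorem coeff_eq_zero_of_chenRep (c : List E × G.GenVertex →₀ R) (v : V)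
    (h : ∀ N, ∃ y : G.BasisPath, source y = v ∧ (∀ d, 0 < d → d ≤ N → ¬ IsPeriodic y d) ∧
      G.chenRep R (c.sum fun q r => r • sp G R q.1 q.2) (Finsupp.single y 1) = 0)
    (α : List E) (hα : G.Composable α v) :
    ∑ q ∈ c.support with q.1 = α ∧ v ∈ q.2.1, c q = 0 := by
  obtain ⟨y, rfl, hper, hy⟩ := h (max α.length (c.support.sup fun q => q.1.length))
  rw [Finsupp.sum, map_sum, LinearMap.sum_apply] at hy
  replace hy := DFunLike.congr_fun hy (append α y)
  rw [Finsupp.finsetSum_apply] at hy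
  rw [Finset.sum_filter]
  refine Eq.trans (Finset.sum_congr rfl fun q hq => ?_) hy
  rw [map_smul, LinearMap.smul_apply, chenRep_sp_single]
  by_cases h₁ : source y ∈ q.2.1 ∧ G.Composable q.1 (source y)
  · rw [if_pos h₁]
    by_cases h₂ : q.1 = α
    · simp [h₁.1, h₂]
    · rw [if_neg fun h => h₂ h.1, Finsupp.smul_apply, Finsupp.single_eq_of_ne, smul_zero]
      intro h₃
      exact h₂ (append_injective hper h₁.2 hα
        ((Finset.le_sup (f := fun q : List E × G.GenVertex => q.1.length) hq).trans
          (le_max_right _ _)) (le_max_left _ _) h₃.symm)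
  · rw [if_neg h₁, if_neg]
    · simp
    · rintro ⟨rfl, h₂⟩
      exact h₁ ⟨h₂, hα⟩

namespace LeavittPathAlgebra

theorem p_finset (T : Finset V) :
    p G R ⟨T, G.isGenVertex_of_finite T.finite_toSet⟩ = ∑ v ∈ T, p G R (.single G v) := by
  classical
  induction T using Finset.induction_on with
  | empty => exact p_eq_zero G R (by simp)
  | insert v T hv ih =>
    have h := p_sup_add_p_inf G R (.single G v) ⟨T, G.isGenVertex_of_finite T.finite_toSet⟩
    rw [p_eq_zero G R (A := _ ⊓ _) (Set.singleton_inter_eq_empty.2 (by simpa using hv)),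
      add_zero, ih] at h
    rw [Finset.sum_insert hv, ← h]
    congr 1
    exact Subtype.ext (by simp; rfl)

end LeavittPathAlgebra

theorem eq_zero_of_chenRep_of_real (hL : G.ConditionL) {z : G.LeavittPathAlgebra R}
    (hz : z ∈ real G R) (F : Finset E)
    (h : G.chenRep R (z - ∑ e ∈ F, z * LeavittPathAlgebra.s G R e * sStar G R e) = 0) :
    z - ∑ e ∈ F, z * LeavittPathAlgebra.s G R e * sStar G R e = 0 := by
  classical
  obtain ⟨c, rfl⟩ := Finsupp.mem_span_range_iff_exists_finsupp.1 hz
  set z := c.sum fun q r => r • sp G R q.1 q.2 with hzdef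
  let T : Finset V := (F.image G.src).filter fun v => ∀ e, G.src e = v → e ∈ F
  let A : G.GenVertex := ⟨T, G.isGenVertex_of_finite T.finite_toSet⟩
  have hzT : z = z * p G R A := real_eq_mul_p c A fun α v hvT hα => by
    refine coeff_eq_zero_of_chenRep c v (fun N => ?_) α hα
    obtain ⟨y₀, hy₀, hfirst⟩ : ∃ y₀ : G.BasisPath, source y₀ = v ∧
        ∀ e ∈ F, first y₀ ≠ some e := by
      by_cases hv : G.IsSink v
      · exact ⟨fin [] v ⟨List.isChain_nil, by simp, hv⟩, rfl, by simp [first]⟩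
      obtain ⟨e, rfl, he⟩ : ∃ e, G.src e = v ∧ e ∉ F := by
        by_contra! hc
        simp only [IsSink, not_forall, not_not] at hv
        obtain ⟨e, rfl⟩ := hv
        exact hvT (Finset.mem_coe.2 (Finset.mem_filter.2
          ⟨Finset.mem_image_of_mem _ (hc e rfl), hc⟩))
      obtain ⟨w, hw⟩ := G.rng_nonempty e
      obtain ⟨y, rfl⟩ := exists_source_eq G w
      refine ⟨cons e y hw, source_cons e y hw, fun f hf h => he ?_⟩
      rw [first_cons] at h
      exact Option.some_injective _ h ▸ hf
    obtain ⟨y, hy, hy', hper⟩ := exists_not_isPeriodic hL N y₀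
    refine ⟨y, hy.trans hy₀, hper, ?_⟩
    have h₁ := LinearMap.congr_fun h (Finsupp.single y 1)
    rw [map_sub, LinearMap.sub_apply, map_sum, LinearMap.sum_apply, Finset.sum_eq_zero,
      sub_zero] at h₁
    · exact h₁
    · intro e he
      rw [map_mul, Module.End.mul_apply, chenRep_sStar_single G R (hy' ▸ hfirst e he), map_zero]
  have hzv : ∀ e, G.src e ∉ T → z * LeavittPathAlgebra.s G R e = 0 := fun e he => by
    rw [hzT, mul_assoc, p_mul_s_of_notMem G R (A := A) (by simpa [A] using he), mul_zero]
  have h₁ : ∑ e ∈ F, z * LeavittPathAlgebra.s G R e * sStar G R e =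
      ∑ e ∈ F with G.src e ∈ T, z * LeavittPathAlgebra.s G R e * sStar G R e := by
    refine (Finset.sum_filter_of_ne fun e _ hne => ?_).symm
    by_contra he
    exact hne (by rw [hzv e he, zero_mul])
  rw [h₁, ← Finset.sum_fiberwise_of_maps_to (t := T) (g := G.src) fun e he =>
    (Finset.mem_filter.1 he).2, sub_eq_zero]
  conv_lhs => rw [hzT, p_finset, Finset.mul_sum]
  refine Finset.sum_congr rfl fun v hv => ?_
  obtain ⟨hv₁, hv₂⟩ := Finset.mem_filter.1 hv
  have hset : {e | G.src e = v} = (F.filter fun e => G.src e = v : Finset E) := by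
    ext e
    simpa using fun he => hv₂ e he
  have hfin : {e | G.src e = v}.Finite := hset ▸ Finset.finite_toSet _
  rw [p_single G R v hfin (by
    obtain ⟨e, -, he⟩ := Finset.mem_image.1 hv₁
    exact ⟨e, he⟩), Finset.mul_sum]
  refine Finset.sum_congr ?_ fun e _ => (mul_assoc _ _ _).symm
  ext e
  simp only [Set.Finite.mem_toFinset, Set.mem_ofPred_eq, Finset.mem_filter]
  exact ⟨fun he => ⟨⟨hv₂ e he, he ▸ hv⟩, he⟩, fun he => he.2⟩

theorem eq_zero_of_chenRep_eq_zero (hL : G.ConditionL) {n : ℕ} {x : G.LeavittPathAlgebra R}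
    (hx : x ∈ filtration G R n) (h : G.chenRep R x = 0) : x = 0 := by
  classical
  induction n generalizing x with
  | zero => simpa using eq_zero_of_chenRep_of_real hL hx ∅ (by simpa using h)
  | succ n ih =>
    have hs : ∀ e, x * LeavittPathAlgebra.s G R e = 0 := fun e =>
      ih (filtration_succ_mul_s hx e) (by rw [map_mul, h, zero_mul])
    obtain ⟨z, hz, F, y, hy, hxz⟩ := mem_filtration_succ.1 hx
    have hxF : x = z - ∑ e ∈ F, z * LeavittPathAlgebra.s G R e * sStar G R e := by
      -- $xs_e=0$ reads $y_ep_{r(e)}=-zs_e$, and $s_e^*$ absorbs $p_{r(e)}$.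
      have hterm : ∀ e ∈ F,
          y e * sStar G R e = -(z * LeavittPathAlgebra.s G R e * sStar G R e) := fun e he => by
        have h₁ := hs e
        rw [hxz, add_mul, Finset.sum_mul, Finset.sum_eq_single_of_mem e he fun f _ hf => by
          rw [mul_assoc, sStar_mul_s_ne G R hf, mul_zero], mul_assoc, sStar_mul_s_self] at h₁
        rw [← p_rng_mul_sStar, ← mul_assoc (y e), eq_neg_of_add_eq_zero_right h₁, neg_mul,
          mul_assoc, p_rng_mul_sStar, mul_assoc]
      rw [hxz, Finset.sum_congr rfl hterm, Finset.sum_neg_distrib, sub_eq_add_neg]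
    rw [hxF]
    exact eq_zero_of_chenRep_of_real hL hz F (hxF ▸ h)

theorem chenRep_injective (hL : G.ConditionL) : Function.Injective (G.chenRep R) := by
  refine (injective_iff_map_eq_zero _).2 fun x hx => ?_
  obtain ⟨n, hn⟩ := exists_mem_filtration x
  exact eq_zero_of_chenRep_eq_zero hL hn hx

end Representation

end Ultragraph

/-! ### Faithfulness implies Condition (L) -/

namespace Ultragraph

open BasisPath LeavittPathAlgebra

variable {V : Type u} {E : Type v} {G : Ultragraph V E}

theorem IsPath.composable {α : List E} (hα : G.IsPath α) {w : V}
    (hw : ∀ e ∈ α.getLast?, w ∈ G.rng e) : G.Composable α w := by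
  induction α with
  | nil => trivial
  | cons e α ih =>
    cases α with
    | nil => exact ⟨hw e rfl, trivial⟩
    | cons f α =>
      have h := List.isChain_cons_cons.1 hα
      exact ⟨h.1, ih h.2 (by simpa using hw)⟩

theorem first_eq_of_not_hasExit {α : List E} (h : ¬ G.HasExit α) {i : ℕ} (hi : i < α.length)
    {y : G.BasisPath} (hy : source y ∈ G.rng α[i]) :
    first y = some (α[(i + 1) % α.length]'(Nat.mod_lt _ (by omega))) := by
  by_contra hne
  refine h ⟨i, hi, ?_⟩
  cases hf : first y with
  | none =>
    rcases y with ⟨_ | _, w, hw⟩ | _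
    · exact .inr ⟨w, hw.2.2, hy⟩
    · simp [first] at hf
    · simp [first] at hf
  | some e =>
    refine .inl ⟨e, source_of_first hf ▸ hy, ?_⟩
    rintro rfl
    exact hne hf

/-- Without exits each next edge is forced, and no sink is ever reached. -/
theorem eq_of_not_hasExit {α : List E} (h : ¬ G.HasExit α) {i : ℕ} (hi : i < α.length)
    {y y' : G.BasisPath} (hy : source y ∈ G.rng α[i]) (hy' : source y' ∈ G.rng α[i]) : y = y' := by
  have key : ∀ (n i : ℕ) (hi : i < α.length) (y y' : G.BasisPath), source y ∈ G.rng α[i] →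
      source y' ∈ G.rng α[i] → edge y n = edge y' n ∧ edge y n ≠ none := fun n => by
    induction n with
    | zero =>
      intro i hi y y' hy hy'
      rw [edge_zero, edge_zero, first_eq_of_not_hasExit h hi hy, first_eq_of_not_hasExit h hi hy']
      exact ⟨rfl, by simp⟩
    | succ n ih =>
      intro i hi y y' hy hy'
      have h₁ := first_eq_of_not_hasExit h hi hy
      have h₂ := first_eq_of_not_hasExit h hi hy'
      rw [← edge_tail h₁, ← edge_tail h₂]
      exact ih _ _ _ _ (source_tail_mem h₁) (source_tail_mem h₂)
  exact ext_of_edge (fun n => (key n i hi y y' hy hy').1) fun n => (key n i hi y y' hy hy').2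

namespace LeavittPathAlgebra

variable {R : Type w} [CommRing R] {A : Type*} [Ring A] [Module R A] [IsScalarTower R A A]
  [SMulCommClass R A A]

/-- The values of a family on the generators, placed in the degrees of the `ℤ`-grading in which
`s_e` has degree `1` and `s_e^*` has degree `-1`. -/
noncomputable def graded (f : G.Gen → A) : G.Gen → AddMonoidAlgebra A ℤ
  | .p B => .single (0 : ℤ) (f (.p B))
  | .s e => .single 1 (f (.s e))
  | .sStar e => .single (-1) (f (.sStar e))

/-- All relations are homogeneous. Lifting to $A[\mathbb Z]$ thus detects degrees without a grading
on the algebra itself. -/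
theorem Satisfies.graded {f : G.Gen → A} (h : Satisfies G f) : Satisfies G (graded f) := by
  have hmul : ∀ (m n : ℤ) (a b : A), (AddMonoidAlgebra.single m a * .single n b :
      AddMonoidAlgebra A ℤ) = .single (m + n) (a * b) := AddMonoidAlgebra.single_mul_single
  constructor
  · simp only [LeavittPathAlgebra.graded, h.p_empty, AddMonoidAlgebra.single_zero]
  · intro A B
    simp only [LeavittPathAlgebra.graded, hmul, h.p_inter, add_zero]
  · intro A B
    simp only [LeavittPathAlgebra.graded, h.p_union, AddMonoidAlgebra.single_add,
      AddMonoidAlgebra.single_sub]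
  · intro e
    simp only [LeavittPathAlgebra.graded, hmul, h.src_s, zero_add]
  · intro e
    simp only [LeavittPathAlgebra.graded, hmul, h.s_rng, add_zero]
  · intro e
    simp only [LeavittPathAlgebra.graded, hmul, h.rng_sStar, zero_add]
  · intro e
    simp only [LeavittPathAlgebra.graded, hmul, h.sStar_src, add_zero]
  · intro e
    simp only [LeavittPathAlgebra.graded, hmul, h.sStar_s_self, neg_add_cancel]
  · intro e f hef
    simp only [LeavittPathAlgebra.graded, hmul, h.sStar_s_ne e f hef, AddMonoidAlgebra.single_zero]
  · intro v hfin hne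
    simp only [LeavittPathAlgebra.graded, hmul,
      h.p_vertex v hfin hne, add_neg_cancel]
    exact map_sum (AddMonoidAlgebra.singleAddHom 0) _ _

theorem lift_graded_sp {f : G.Gen → A} (h : Satisfies G f) (α : List E) (B : G.GenVertex) :
    lift R (graded f) h.graded (sp G R α B) = .single (α.length : ℤ) (lift R f h (sp G R α B)) := by
  induction α with
  | nil =>
    simp only [sp, p, lift_of]
    rfl
  | cons e α ih =>
    have he : lift R (graded f) h.graded (s G R e) = .single 1 (f (.s e)) := lift_of R _ _ _
    rw [sp, map_mul, map_mul, ih, he, AddMonoidAlgebra.single_mul_single, s,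
      lift_of, List.length_cons, Nat.cast_succ, add_comm]

/-- Elements `s_α p_B` with `α` of different lengths are equal only if every homomorphism that is
given by a family of elements of a ring kills them. -/
theorem lift_sp_eq_zero_of_sp_eq {f : G.Gen → A} (h : Satisfies G f) {α β : List E}
    {B C : G.GenVertex} (hlen : α.length ≠ β.length) (heq : sp G R α B = sp G R β C) :
    lift R f h (sp G R β C) = 0 := by
  have hdeg := congrArg (lift R (graded f) h.graded) heq
  rw [lift_graded_sp h, lift_graded_sp h, AddMonoidAlgebra.single_inj] at hdeg
  rcases hdeg with ⟨h, -⟩ | ⟨-, h⟩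
  · exact absurd (by exact_mod_cast h) hlen
  · exact h

end LeavittPathAlgebra

variable {R : Type w} [CommRing R]

theorem conditionL_of_chenRep_injective [Nontrivial R]
    (hinj : Function.Injective (G.chenRep R)) : G.ConditionL := by
  intro α hα
  by_contra hexit
  obtain ⟨hpath, hne, hclosed⟩ := hα
  have hlen : α.length - 1 < α.length := Nat.sub_lt (List.length_pos_iff.2 hne) one_pos
  have hlast : α.getLast hne = α[α.length - 1] := List.getLast_eq_getElem hne
  set v := G.src (α.head hne) with hv
  have hcomp : G.Composable α v := hpath.composable fun e he => by
    rw [List.getLast?_eq_some_getLast hne, Option.mem_some_iff] at he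
    exact he ▸ hclosed
  have hsource : G.listSource α v = v := by
    cases α with
    | nil => exact absurd rfl hne
    | cons e α => rfl
  have heq : sp G R α (.single G v) = sp G R [] (.single G v) := hinj <| by
    ext1 y
    ext1
    simp only [LinearMap.comp_apply, Finsupp.lsingle_apply]
    rw [chenRep_sp_single, chenRep_sp_single]
    by_cases hy : source y = v
    · have hs : source (append α y) = v := by
        rw [source_append (hy ▸ hcomp), hy, hsource]
      -- $\alpha y$ and $y$ both start at $v\in r(\alpha)$, so they coincide.
      rw [if_pos ⟨hy, hy ▸ hcomp⟩, if_pos ⟨hy, trivial⟩,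
        eq_of_not_hasExit hexit hlen (y := append α y) (y' := y)
          (by rwa [hs, ← hlast]) (by rwa [hy, ← hlast])]
      rfl
    · rw [if_neg fun h => hy h.1, if_neg fun h => hy h.1]
  have hzero : G.chenRep R (sp G R [] (.single G v)) = 0 :=
    lift_sp_eq_zero_of_sp_eq (G.act_satisfies R) (by simpa using hne) heq
  obtain ⟨y, hy⟩ := exists_source_eq G v
  have h₁ := LinearMap.congr_fun hzero (Finsupp.single y 1)
  rw [chenRep_sp_single, if_pos ⟨hy, trivial⟩, LinearMap.zero_apply,
    Finsupp.single_eq_zero] at h₁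
  exact one_ne_zero h₁

end Ultragraph

theorem mainTheorem3 {V : Type u} {E : Type v} {R : Type w} [Countable V] [Countable E]
    [CommRing R] [Nontrivial R] (G : Ultragraph V E) :
    Function.Injective (G.chenRep R) ↔ G.ConditionL := by
  exact ⟨Ultragraph.conditionL_of_chenRep_injective, Ultragraph.chenRep_injective⟩
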